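/- A doodle diagram is a connected $4$-valent plane graph $D$ (loops and parallel edges allowed, at least one vertex) on the sphere $S^2$. Its vertices are called crossings, and its regions are the components of $S^2\setminus D$; they are the $2$-cells of a cell subdivision of $S^2$ with $1$-skeleton $D$. The diagram is minimal if no region is a monogon or a bigon, that is, no region has a boundary curve consisting of exactly one or exactly two edges. It is prime if it is $3$-connected, that is, it has more than $3$ vertices and the removal of fewer than $3$ vertices never disconnects it. For a region $R$ (chosen as the infinite region), the inner complement $R^c$ is the closed subcomplex of this cell subdivision consisting of all vertices, closed edges and closed regions that are disjoint from the boundary of $R$. Theorem 4.3. Let $D$ be a minimal prime doodle diagram on the sphere. Then for every region $R$ of $D$ the inner complement $R^c$ is acyclic, in the sense that $H_1(R^c;\mathbb Z)=0$, and $R^c$ contains at least one region. -/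

import Mathlib

/-- A connected doodle diagram on the sphere with at least one crossing, regarded as a connected
4-valent plane graph (loops and parallel edges allowed) and recorded by its combinatorial map.
`D` is the set of darts (half-edges; a dart is also an edge together with a direction, starting at
the vertex to which the half-edge is attached).  `vertexPerm` sends a dart to the next one in the
counterclockwise order around its vertex and `edgePerm` sends a dart to the opposite half of the
same edge.  The cell subdivision of a closed oriented surface obtained by gluing discs along the
face cycles is a sphere exactly when its Euler characteristic is two. -/
structure DoodleDiagram (D : Type*) [Fintype D] where
  /-- the next dart counterclockwise around the same vertex -/
  vertexPerm : Equiv.Perm D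
  /-- the other half of the same edge, that is, the edge traversed backwards -/
  edgePerm : Equiv.Perm D
  edgePerm_edgePerm : ∀ d, edgePerm (edgePerm d) = d
  edgePerm_ne : ∀ d, edgePerm d ≠ d
  /-- every vertex has valency four -/
  fourValent : ∀ d, {e | vertexPerm.SameCycle d e}.ncard = 4
  /-- the diagram is connected -/
  connected : ∀ d e, ∃ g ∈ Subgroup.closure {vertexPerm, edgePerm}, g d = e
  /-- the underlying surface is the sphere: `V - E + F = 2`; the faces are the cycles of
  `vertexPerm⁻¹ * edgePerm` -/
  spherical :
    Nat.card (Quotient (Equiv.Perm.SameCycle.setoid vertexPerm)) +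
      Nat.card (Quotient (Equiv.Perm.SameCycle.setoid (vertexPerm⁻¹ * edgePerm))) =
    Nat.card (Quotient (Equiv.Perm.SameCycle.setoid edgePerm)) + 2

namespace DoodleDiagram

variable {D : Type*} [Fintype D] (M : DoodleDiagram D)

/-- Go along a dart to its end and take the next dart clockwise from the reversed one: this is the
next dart on the boundary curve of the region on the left of the given dart. -/
def facePerm : Equiv.Perm D := M.vertexPerm⁻¹ * M.edgePerm

/-- The vertices (crossings) of the diagram. -/
def Vertex : Type _ := Quotient (Equiv.Perm.SameCycle.setoid M.vertexPerm)

/-- The edges of the diagram. -/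
def Edge : Type _ := Quotient (Equiv.Perm.SameCycle.setoid M.edgePerm)

/-- The regions of the diagram, i.e. the components of its complement in the sphere. -/
def Region : Type _ := Quotient (Equiv.Perm.SameCycle.setoid M.facePerm)

/-- The vertex from which a dart starts. -/
def origin (d : D) : M.Vertex := Quotient.mk (Equiv.Perm.SameCycle.setoid M.vertexPerm) d

/-- The vertex at which a dart ends. -/
def target (d : D) : M.Vertex := M.origin (M.edgePerm d)

/-- The edge that contains a dart. -/
def edge (d : D) : M.Edge := Quotient.mk (Equiv.Perm.SameCycle.setoid M.edgePerm) d

/-- The region on the left of a dart. -/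
def region (d : D) : M.Region := Quotient.mk (Equiv.Perm.SameCycle.setoid M.facePerm) d

/-- The number of edges in the boundary curve of a region: an `i`-gon has boundary length `i`. -/
noncomputable def boundaryLength (F : M.Region) : ℕ := {d | M.region d = F}.ncard

/-- The vertices on the boundary of a region. -/
def boundaryVertices (F : M.Region) : Set M.Vertex := {v | ∃ d, M.region d = F ∧ M.origin d = v}

/-- The diagram is minimal: it has no monogons and no bigons. -/
def IsMinimal : Prop := ∀ F : M.Region, M.boundaryLength F ≠ 1 ∧ M.boundaryLength F ≠ 2

/-- The simple graph of adjacency between distinct vertices, forgetting loops and multiplicities. -/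
def graph : SimpleGraph M.Vertex where
  Adj u v := u ≠ v ∧ ∃ d, M.origin d = u ∧ M.target d = v
  symm := ⟨by
    rintro u v ⟨h, d, rfl, rfl⟩
    exact ⟨h.symm, M.edgePerm d, rfl, by simp [target, M.edgePerm_edgePerm]⟩⟩
  loopless := ⟨fun _ h => h.1 rfl⟩

/-- The diagram is `k`-connected: it has more than `k` vertices and is not disconnected whenever
fewer than `k` vertices are removed. -/
def IsKConnected (k : ℕ) : Prop :=
  k < Nat.card M.Vertex ∧
    ∀ S : Set M.Vertex, S.ncard < k → (M.graph.induce Sᶜ).Connected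

/-- A diagram is prime if it is 3-connected. -/
def IsPrime : Prop := M.IsKConnected 3

/-- A closed subcomplex of the cell subdivision of the sphere defined by the diagram. -/
structure Subcomplex where
  vertices : Set M.Vertex
  edges : Set M.Edge
  regions : Set M.Region
  origin_mem : ∀ d, M.edge d ∈ edges → M.origin d ∈ vertices
  edge_mem : ∀ d, M.region d ∈ regions → M.edge d ∈ edges

theorem edge_edgePerm (d : D) : M.edge (M.edgePerm d) = M.edge d :=
  Quotient.sound (s := Equiv.Perm.SameCycle.setoid M.edgePerm)
    (Equiv.Perm.sameCycle_apply_left.2 (Equiv.Perm.SameCycle.refl _ _))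

theorem region_facePerm (d : D) : M.region (M.facePerm d) = M.region d :=
  Quotient.sound (s := Equiv.Perm.SameCycle.setoid M.facePerm)
    (Equiv.Perm.sameCycle_apply_left.2 (Equiv.Perm.SameCycle.refl _ _))

theorem origin_vertexPerm (d : D) : M.origin (M.vertexPerm d) = M.origin d :=
  Quotient.sound (s := Equiv.Perm.SameCycle.setoid M.vertexPerm)
    (Equiv.Perm.sameCycle_apply_left.2 (Equiv.Perm.SameCycle.refl _ _))

theorem origin_facePerm (d : D) : M.origin (M.facePerm d) = M.target d := by
  rw [← M.origin_vertexPerm (M.facePerm d)]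
  simp [facePerm, target]

/-- The inner complement of the region `R`: all vertices, (closed) edges and (closed) regions that
have no point in common with the boundary of `R`.  As two closed cells that meet have a vertex in
common, these are the cells none of whose vertices lies on the boundary of `R`. -/
def innerComplement (R : M.Region) : M.Subcomplex where
  vertices := {v | v ∉ M.boundaryVertices R}
  edges := {e | ∀ d, M.edge d = e → M.origin d ∉ M.boundaryVertices R}
  regions := {F | ∀ d, M.region d = F → M.origin d ∉ M.boundaryVertices R}
  origin_mem := fun d h => h d rfl
  edge_mem := by
    intro d h d' hd'
    have hc : M.edgePerm.SameCycle d' d :=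
      Quotient.exact (s := Equiv.Perm.SameCycle.setoid M.edgePerm) hd'
    have hcases : d' = d ∨ d' = M.edgePerm d := by
      obtain ⟨i, rfl⟩ := hc
      have hsq : M.edgePerm * M.edgePerm = 1 := Equiv.ext M.edgePerm_edgePerm
      have h2 : M.edgePerm ^ (2 : ℤ) = 1 := by
        rw [zpow_two, hsq]
      rcases Int.even_or_odd i with ⟨j, hj⟩ | ⟨j, hj⟩
      · left
        have : M.edgePerm ^ i = 1 := by rw [hj, ← two_mul, zpow_mul, h2, one_zpow]
        simp [this]
      · right
        have : M.edgePerm ^ i = M.edgePerm := by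
          rw [hj, zpow_add, zpow_mul, h2, one_zpow, one_mul, zpow_one]
        simp [this, M.edgePerm_edgePerm]
    rcases hcases with rfl | rfl
    · exact h _ rfl
    · have := h (M.facePerm d) (M.region_facePerm d)
      rwa [M.origin_facePerm] at this

/-! ### Cellular chains with integer coefficients

A 2-chain is a function on regions (each oriented counterclockwise).  A 1-chain is an antisymmetric
function on darts; an oriented edge `d` is the function with value `1` at `d`, value `-1` at the
reversed dart and value `0` elsewhere.  A 0-chain is a function on vertices. -/

/-- The boundary of a 2-chain: the coefficient of the edge `d` is that of the region on its left
minus that of the region on its right. -/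
def boundary₂ : (M.Region → ℤ) →ₗ[ℤ] (D → ℤ) where
  toFun g d := g (M.region d) - g (M.region (M.edgePerm d))
  map_add' f g := by
    funext d
    simp only [Pi.add_apply]
    ring
  map_smul' c g := by
    funext d
    simp only [Pi.smul_apply, smul_eq_mul, RingHom.id_apply]
    ring

open Classical in
/-- The boundary of a 1-chain; the oriented edge `d` has boundary `target d - origin d`. -/
noncomputable def boundary₁ : (D → ℤ) →ₗ[ℤ] (M.Vertex → ℤ) where
  toFun f v := ∑ d, if M.target d = v then f d else 0
  map_add' f g := by
    funext v
    simp only [Pi.add_apply, ← Finset.sum_add_distrib]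
    refine Finset.sum_congr rfl fun d _ => ?_
    split_ifs <;> simp
  map_smul' c f := by
    funext v
    simp only [Pi.smul_apply, smul_eq_mul, RingHom.id_apply, Finset.mul_sum]
    refine Finset.sum_congr rfl fun d _ => ?_
    split_ifs <;> simp

theorem boundary₁_boundary₂ (g : M.Region → ℤ) : M.boundary₁ (M.boundary₂ g) = 0 := by
  classical
  funext v
  have h1 : ∑ d, (if M.target d = v then g (M.region d) else 0) =
      ∑ d, (if M.origin d = v then g (M.region d) else 0) := by
    rw [← Equiv.sum_comp M.facePerm (fun d => if M.origin d = v then g (M.region d) else 0)]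
    simp only [M.origin_facePerm, M.region_facePerm]
  have h2 : ∑ d, (if M.target d = v then g (M.region (M.edgePerm d)) else 0) =
      ∑ d, (if M.origin d = v then g (M.region d) else 0) :=
    Equiv.sum_comp M.edgePerm (fun d => if M.origin d = v then g (M.region d) else 0)
  have h3 : M.boundary₁ (M.boundary₂ g) v =
      ∑ d, (if M.target d = v then g (M.region d) else 0) -
        ∑ d, (if M.target d = v then g (M.region (M.edgePerm d)) else 0) := by
    rw [← Finset.sum_sub_distrib]
    refine Finset.sum_congr rfl fun d _ => ?_
    simp only [boundary₂, LinearMap.coe_mk, AddHom.coe_mk]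
    split_ifs <;> simp
  rw [h3, h1, h2, sub_self]
  rfl

namespace Subcomplex

variable {M} (K : M.Subcomplex)

/-- The cellular 2-chains of a subcomplex. -/
def chains₂ : Submodule ℤ (M.Region → ℤ) where
  carrier := {g | ∀ F, F ∉ K.regions → g F = 0}
  zero_mem' := by simp
  add_mem' := by
    intro f g hf hg F hF
    simp [hf F hF, hg F hF]
  smul_mem' := by
    intro c g hg F hF
    simp [hg F hF]

/-- The cellular 1-chains of a subcomplex. -/
def chains₁ : Submodule ℤ (D → ℤ) where
  carrier := {f | (∀ d, f (M.edgePerm d) = -f d) ∧ ∀ d, M.edge d ∉ K.edges → f d = 0}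
  zero_mem' := by simp
  add_mem' := by
    intro f g hf hg
    refine ⟨fun d => ?_, fun d hd => ?_⟩
    · simp only [Pi.add_apply, hf.1 d, hg.1 d]
      ring
    · simp [hf.2 d hd, hg.2 d hd]
  smul_mem' := by
    intro c f hf
    refine ⟨fun d => ?_, fun d hd => ?_⟩
    · simp [hf.1 d]
    · simp [hf.2 d hd]

/-- The cellular 1-cycles of a subcomplex. -/
noncomputable def cycles₁ : Submodule ℤ (D → ℤ) := K.chains₁ ⊓ LinearMap.ker M.boundary₁

/-- The cellular 1-boundaries of a subcomplex. -/
def boundaries₁ : Submodule ℤ (D → ℤ) := K.chains₂.map M.boundary₂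

theorem boundaries₁_le_cycles₁ : K.boundaries₁ ≤ K.cycles₁ := by
  rintro _ ⟨g, hg, rfl⟩
  refine ⟨⟨fun d => ?_, fun d hd => ?_⟩, M.boundary₁_boundary₂ g⟩
  · simp only [boundary₂, LinearMap.coe_mk, AddHom.coe_mk, M.edgePerm_edgePerm]
    ring
  · have h1 : g (M.region d) = 0 := hg _ fun h => hd (K.edge_mem d h)
    have h2 : g (M.region (M.edgePerm d)) = 0 :=
      hg _ fun h => hd (M.edge_edgePerm d ▸ K.edge_mem _ h)
    simp [boundary₂, h1, h2]

/-- The first cellular homology group, with integer coefficients, of a subcomplex. -/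
abbrev H₁ : Type _ := K.cycles₁ ⧸ K.boundaries₁.submoduleOf K.cycles₁

end Subcomplex

end DoodleDiagram

/-! Acyclicity needs neither minimality nor primeness. A 1-cycle `f` of the inner complement bounds
on the sphere, so it is the jump across edges of a function `g` on regions. It vanishes on every
edge at a vertex of the boundary of `R`, hence `g` has the same value on all regions around such a
vertex, namely `g R`. So `g R - g F` vanishes on every region `F` that meets the boundary of `R`,
and up to sign convention this is the 2-chain that `f` bounds.

That a region survives is a count. Closed curves through few vertices, combined with
3-connectedness, give three facts: a region has at most one corner at a vertex
(`IsPrime.eq_of_region_eq`); two regions that share two vertices share an edge between them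
(`common_edge`); and a vertex off the boundary of `R` does not send three consecutive edges to that
boundary (`not_three_consecutive`). Let `R` be an `n`-gon and suppose that every region meets its
boundary. There are at most `2n + 1` regions, and since regions outnumber vertices by two, at most
`n - 1` vertices lie off the boundary. But each of the `n` boundary vertices sends two edges
outwards, and each outer vertex receives at most two of these `2n` edges, so there are at least `n`
outer vertices.

The Jordan curve theorem enters as linear algebra: the first (co)homology of a connected surface of
Euler characteristic two vanishes. A closed curve is thereby encoded as a function on edges that
jumps only at the corners through which the curve enters or leaves a vertex. -/

/-! ### Exactness for Euler characteristic two, over the rationals and the integers. -/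

/-- The rank of a linear map whose kernel consists of constant functions. -/
theorem card_le_finrank_range_add_one {D X : Type*} [Fintype D] [Fintype X]
    (δ : (X → ℚ) →ₗ[ℚ] (D → ℚ)) (hδ : ∀ q, δ q = 0 → ∀ x y, q x = q y) :
    Fintype.card X ≤ Module.finrank ℚ (LinearMap.range δ) + 1 := by
  have h1 := LinearMap.finrank_range_add_finrank_ker δ
  have h2 : LinearMap.ker δ ≤ Submodule.span ℚ {fun _ => (1 : ℚ)} := by
    intro q hq
    rw [Submodule.mem_span_singleton]
    rcases isEmpty_or_nonempty X with hX | ⟨⟨x⟩⟩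
    · exact ⟨0, Subsingleton.elim _ _⟩
    · refine ⟨q x, funext fun y => ?_⟩
      simpa using hδ q hq x y
  have h3 := Submodule.finrank_mono h2
  have h4 := finrank_span_le_card (R := ℚ) ({fun _ => (1 : ℚ)} : Set (X → ℚ))
  simp only [Set.toFinset_singleton, Finset.card_singleton] at h4
  rw [Module.finrank_fintype_fun_eq_card] at h1
  omega

/-- Exactness, over the rationals, of the cellular cochain complex of a connected surface of Euler
characteristic two, in terms of its darts: an antisymmetric function on darts whose sums around the
faces vanish is a coboundary. -/
theorem exists_rat_potential {D V E F : Type*} [Fintype D] [Fintype V] [Fintype E] [Fintype F]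
    (α : Equiv.Perm D) (hα : ∀ d, α (α d) = d) (o : D → V) (r : D → F) (ε : D → E)
    (hε : Function.Surjective ε) (hεα : ∀ d e, ε d = ε e → e = d ∨ e = α d)
    (hcard : Fintype.card V + Fintype.card F = Fintype.card E + 2)
    (ho : ∀ q : V → ℚ, (∀ d, q (o (α d)) = q (o d)) → ∀ x y, q x = q y)
    (hr : ∀ g : F → ℚ, (∀ d, g (r (α d)) = g (r d)) → ∀ x y, g x = g y)
    (horth : ∀ (q : V → ℚ) (g : F → ℚ),
      ∑ d, q (o (α d)) * g (r d) = ∑ d, q (o d) * g (r d))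
    (f : D → ℚ) (hf : ∀ d, f (α d) = -f d) (hfr : ∀ g : F → ℚ, ∑ d, f d * g (r d) = 0) :
    ∃ q : V → ℚ, ∀ d, f d = q (o (α d)) - q (o d) := by
  classical
  let A : Submodule ℚ (D → ℚ) :=
    { carrier := {f | ∀ d, f (α d) = -f d}
      zero_mem' := by simp
      add_mem' := by
        intro f g hf hg d
        simp only [Pi.add_apply, hf d, hg d]
        ring
      smul_mem' := by
        intro c f hf d
        simp [hf d] }
  let δo : (V → ℚ) →ₗ[ℚ] (D → ℚ) :=
    LinearMap.funLeft ℚ ℚ (fun d => o (α d)) - LinearMap.funLeft ℚ ℚ o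
  let δr : (F → ℚ) →ₗ[ℚ] (D → ℚ) :=
    LinearMap.funLeft ℚ ℚ (fun d => r (α d)) - LinearMap.funLeft ℚ ℚ r
  have hδo : ∀ q d, δo q d = q (o (α d)) - q (o d) := fun q d => rfl
  have hδr : ∀ g d, δr g d = g (r (α d)) - g (r d) := fun q d => rfl
  -- An antisymmetric function is determined by its values on one dart per edge.
  have hA : Module.finrank ℚ A ≤ Fintype.card E := by
    let j : A →ₗ[ℚ] (E → ℚ) :=
      (LinearMap.funLeft ℚ ℚ (Function.surjInv hε)) ∘ₗ A.subtype
    have hj : Function.Injective j := by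
      rw [← LinearMap.ker_eq_bot, LinearMap.ker_eq_bot']
      rintro ⟨x, hx⟩ h0
      ext d
      have h1 : x (Function.surjInv hε (ε d)) = 0 := congrFun h0 (ε d)
      rcases hεα _ _ (Function.surjInv_eq hε (ε d)) with h | h
      · rw [← h] at h1
        exact h1
      · change x d = 0
        rw [h, hx, h1, neg_zero]
    simpa using LinearMap.finrank_le_finrank_of_injective hj
  have hkerF := card_le_finrank_range_add_one δr
    fun g hg => hr g fun d => sub_eq_zero.1 (congrFun hg d)
  have hkerV := card_le_finrank_range_add_one δo
    fun q hq => ho q fun d => sub_eq_zero.1 (congrFun hq d)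
  have hinner : ∀ (x : D → ℚ) (g : F → ℚ), (∀ d, x (α d) = -x d) →
      ∑ d, x d * δr g d = -2 * ∑ d, x d * g (r d) := by
    intro x g hx
    have h1 : ∑ d, x d * g (r (α d)) = -∑ d, x d * g (r d) := by
      rw [← Equiv.sum_comp α, ← Finset.sum_neg_distrib]
      exact Finset.sum_congr rfl fun d _ => by rw [hx, hα, neg_mul]
    simp only [hδr, mul_sub, Finset.sum_sub_distrib, h1]
    ring
  have hδoA : ∀ q d, δo q (α d) = -δo q d := fun q d => by simp only [hδo, hα]; ring
  have hδrA : ∀ q d, δr q (α d) = -δr q d := fun q d => by simp only [hδr, hα]; ring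
  have hoo : ∀ q g, ∑ d, δo q d * δr g d = 0 := by
    intro q g
    rw [hinner _ _ (hδoA q)]
    simp only [hδo, sub_mul, Finset.sum_sub_distrib, horth, sub_self, mul_zero]
  have hzero : ∀ x : D → ℚ, ∑ d, x d * x d = 0 → x = 0 := by
    intro x hx
    rw [Finset.sum_eq_zero_iff_of_nonneg fun d _ => mul_self_nonneg _] at hx
    exact funext fun d => mul_self_eq_zero.1 (hx d (Finset.mem_univ d))
  have hdisj : LinearMap.range δo ⊓ LinearMap.range δr = ⊥ := by
    rw [eq_bot_iff]
    rintro _ ⟨⟨q, rfl⟩, ⟨g, hg⟩⟩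
    refine hzero _ ?_
    have := hoo q g
    rwa [hg] at this
  have hle : LinearMap.range δo ⊔ LinearMap.range δr ≤ A := by
    refine sup_le ?_ ?_
    · rintro _ ⟨q, rfl⟩
      exact hδoA q
    · rintro _ ⟨g, rfl⟩
      exact hδrA g
  have hsum := Submodule.finrank_sup_add_finrank_inf_eq (LinearMap.range δo) (LinearMap.range δr)
  rw [hdisj, finrank_bot] at hsum
  -- The two ranges are orthogonal, so their sum is direct and has dimension at least (V - 1) + (F -
  -- 1) = E, which bounds the dimension of `A`.
  have hEq : LinearMap.range δo ⊔ LinearMap.range δr = A :=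
    Submodule.eq_of_le_of_finrank_le hle (by omega)
  have hfA : f ∈ LinearMap.range δo ⊔ LinearMap.range δr := hEq ▸ hf
  obtain ⟨_, ⟨q, rfl⟩, _, ⟨g, rfl⟩, hqg⟩ := Submodule.mem_sup.1 hfA
  -- Both `f` and `δo q` are orthogonal to the range of `δr`, so `δr g` is orthogonal to itself.
  have hg0 : δr g = 0 := by
    refine hzero _ ?_
    have h1 : ∑ d, f d * δr g d = 0 := by rw [hinner f g hf, hfr, mul_zero]
    rw [← hqg] at h1
    simpa only [Pi.add_apply, add_mul, Finset.sum_add_distrib, hoo, zero_add] using h1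
  refine ⟨q, fun d => ?_⟩
  rw [← hqg, hg0, add_zero, hδo]

/-- The integral version of `exists_rat_potential`. -/
theorem exists_int_potential {D V E F : Type*} [Fintype D] [Fintype V] [Fintype E] [Fintype F]
    (α : Equiv.Perm D) (hα : ∀ d, α (α d) = d) (o : D → V) (r : D → F) (ε : D → E)
    (hε : Function.Surjective ε) (hεα : ∀ d e, ε d = ε e → e = d ∨ e = α d)
    (hcard : Fintype.card V + Fintype.card F = Fintype.card E + 2)
    (ho : ∀ q : V → ℚ, (∀ d, q (o (α d)) = q (o d)) → ∀ x y, q x = q y)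
    (hr : ∀ g : F → ℚ, (∀ d, g (r (α d)) = g (r d)) → ∀ x y, g x = g y)
    (horth : ∀ (q : V → ℚ) (g : F → ℚ),
      ∑ d, q (o (α d)) * g (r d) = ∑ d, q (o d) * g (r d))
    (f : D → ℤ) (hf : ∀ d, f (α d) = -f d)
    (hfr : ∀ g : F → ℚ, ∑ d, (f d : ℚ) * g (r d) = 0) :
    ∃ q : V → ℤ, ∀ d, f d = q (o (α d)) - q (o d) := by
  classical
  obtain ⟨q, hq⟩ := exists_rat_potential α hα o r ε hε hεα hcard ho hr horth (fun d => (f d : ℚ))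
    (fun d => by rw [hf]; push_cast; rfl) hfr
  rcases isEmpty_or_nonempty V with hV | ⟨⟨v₀⟩⟩
  · exact ⟨fun _ => 0, fun d => hV.elim (o d)⟩
  have hint : ∀ v, ∃ z : ℤ, q v - q v₀ = z := by
    intro v
    -- Integrality of `q v - q v₀` propagates along edges because `f` is integral; connectedness,
    -- applied to the indicator function, spreads it from `v₀`.
    have h := ho (fun v => if ∃ z : ℤ, q v - q v₀ = z then 1 else 0) (fun d => by
      have : (∃ z : ℤ, q (o (α d)) - q v₀ = z) ↔ ∃ z : ℤ, q (o d) - q v₀ = z := by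
        constructor
        · rintro ⟨z, hz⟩
          exact ⟨z - f d, by push_cast; rw [← hz, hq]; ring⟩
        · rintro ⟨z, hz⟩
          exact ⟨z + f d, by push_cast; rw [← hz, hq]; ring⟩
      simp only [this]) v₀ v
    by_contra hc
    simp only [if_neg hc] at h
    rw [if_pos ⟨0, by simp⟩] at h
    exact one_ne_zero h
  choose z hz using hint
  refine ⟨z, fun d => ?_⟩
  have : (f d : ℚ) = z (o (α d)) - z (o d) := by rw [← hz, ← hz, hq]; ring
  exact_mod_cast this

/-! ### Homology of the sphere and acyclicity of the inner complement. -/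

namespace DoodleDiagram

variable {D : Type*} [Fintype D] (M : DoodleDiagram D)

instance : Finite M.Vertex := Quotient.finite _
instance : Finite M.Edge := Quotient.finite _
instance : Finite M.Region := Quotient.finite _

theorem origin_surjective : Function.Surjective M.origin := Quotient.mk_surjective
theorem region_surjective : Function.Surjective M.region := Quotient.mk_surjective
theorem edge_surjective : Function.Surjective M.edge := Quotient.mk_surjective

variable {M} in
theorem eq_or_eq_of_edge_eq {d e : D} (h : M.edge d = M.edge e) : e = d ∨ e = M.edgePerm d := by
  obtain ⟨i, rfl⟩ : M.edgePerm.SameCycle d e :=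
    Quotient.exact (s := Equiv.Perm.SameCycle.setoid M.edgePerm) h
  have hsq : M.edgePerm ^ (2 : ℤ) = 1 := by
    rw [zpow_two]
    exact Equiv.ext M.edgePerm_edgePerm
  rcases Int.even_or_odd' i with ⟨j, rfl | rfl⟩
  · left
    rw [zpow_mul, hsq, one_zpow, Equiv.Perm.one_apply]
  · right
    rw [zpow_add, zpow_mul, hsq, one_zpow, one_mul, zpow_one]

theorem vertexPerm_facePerm (d : D) : M.vertexPerm (M.facePerm d) = M.edgePerm d := by
  simp [facePerm]

theorem facePerm_edgePerm_vertexPerm (d : D) :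
    M.facePerm (M.edgePerm (M.vertexPerm d)) = d := by
  simp [facePerm, M.edgePerm_edgePerm]

theorem region_edgePerm_vertexPerm (d : D) :
    M.region (M.edgePerm (M.vertexPerm d)) = M.region d := by
  rw [← M.region_facePerm, M.facePerm_edgePerm_vertexPerm]

/-- A function on darts that is constant around vertices and along edges is constant. -/
theorem eq_of_invariant {X : Type*} (t : D → X) (hv : ∀ d, t (M.vertexPerm d) = t d)
    (he : ∀ d, t (M.edgePerm d) = t d) (d e : D) : t d = t e := by
  obtain ⟨g, hg, rfl⟩ := M.connected d e
  induction hg using Subgroup.closure_induction generalizing d with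
  | mem x hx =>
    rcases hx with rfl | rfl
    · exact (hv d).symm
    · exact (he d).symm
  | one => rfl
  | mul x y _ _ hx hy =>
    rw [Equiv.Perm.mul_apply, ← hx (y d), ← hy d]
  | inv x _ hx =>
    have := hx (x⁻¹ d)
    rw [← Equiv.Perm.mul_apply, mul_inv_cancel, Equiv.Perm.one_apply] at this
    exact this.symm

theorem card_vertex_add_card_region :
    Nat.card M.Vertex + Nat.card M.Region = Nat.card M.Edge + 2 :=
  M.spherical

theorem eq_of_vertex_invariant (q : M.Vertex → ℚ)
    (h : ∀ d, q (M.origin (M.edgePerm d)) = q (M.origin d)) (x y : M.Vertex) : q x = q y := by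
  obtain ⟨d, rfl⟩ := M.origin_surjective x
  obtain ⟨e, rfl⟩ := M.origin_surjective y
  exact M.eq_of_invariant (fun d => q (M.origin d)) (fun d => by rw [M.origin_vertexPerm]) h d e

theorem eq_of_region_invariant (g : M.Region → ℚ)
    (h : ∀ d, g (M.region (M.edgePerm d)) = g (M.region d)) (x y : M.Region) : g x = g y := by
  obtain ⟨d, rfl⟩ := M.region_surjective x
  obtain ⟨e, rfl⟩ := M.region_surjective y
  refine M.eq_of_invariant (fun d => g (M.region d)) (fun d => ?_) h d e
  rw [← h, M.region_edgePerm_vertexPerm]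

theorem sum_origin_region (q : M.Vertex → ℚ) (g : M.Region → ℚ) :
    ∑ d, q (M.origin (M.edgePerm d)) * g (M.region d) =
      ∑ d, q (M.origin d) * g (M.region d) := by
  rw [← Equiv.sum_comp M.facePerm fun d => q (M.origin d) * g (M.region d)]
  simp only [M.origin_facePerm, M.region_facePerm, target]

theorem sum_region_origin (g : M.Region → ℚ) (q : M.Vertex → ℚ) :
    ∑ d, g (M.region (M.edgePerm d)) * q (M.origin d) =
      ∑ d, g (M.region d) * q (M.origin d) := by
  rw [← Equiv.sum_comp M.vertexPerm]
  simp only [M.origin_vertexPerm, M.region_edgePerm_vertexPerm]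

/-- The first cohomology of the sphere vanishes. -/
theorem exists_vertex_potential (f : D → ℤ) (hf : ∀ d, f (M.edgePerm d) = -f d)
    (hfr : ∀ g : M.Region → ℚ, ∑ d, (f d : ℚ) * g (M.region d) = 0) :
    ∃ q : M.Vertex → ℤ, ∀ d, f d = q (M.origin (M.edgePerm d)) - q (M.origin d) := by
  have := Fintype.ofFinite M.Vertex
  have := Fintype.ofFinite M.Edge
  have := Fintype.ofFinite M.Region
  refine exists_int_potential M.edgePerm M.edgePerm_edgePerm M.origin M.region M.edge
    M.edge_surjective (fun _ _ => eq_or_eq_of_edge_eq) ?_ M.eq_of_vertex_invariant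
    M.eq_of_region_invariant M.sum_origin_region f hf hfr
  have := M.card_vertex_add_card_region
  simpa only [← Nat.card_eq_fintype_card] using this

/-- The first homology of the sphere vanishes. -/
theorem exists_region_potential (f : D → ℤ) (hf : ∀ d, f (M.edgePerm d) = -f d)
    (hfv : ∀ q : M.Vertex → ℚ, ∑ d, (f d : ℚ) * q (M.origin d) = 0) :
    ∃ g : M.Region → ℤ, ∀ d, f d = g (M.region (M.edgePerm d)) - g (M.region d) := by
  have := Fintype.ofFinite M.Vertex
  have := Fintype.ofFinite M.Edge
  have := Fintype.ofFinite M.Region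
  refine exists_int_potential M.edgePerm M.edgePerm_edgePerm M.region M.origin M.edge
    M.edge_surjective (fun _ _ => eq_or_eq_of_edge_eq) ?_ M.eq_of_region_invariant
    M.eq_of_vertex_invariant M.sum_region_origin f hf hfv
  have := M.card_vertex_add_card_region
  rw [add_comm] at this
  simpa only [← Nat.card_eq_fintype_card] using this

theorem eq_of_origin_eq {X : Type*} (t : D → X) {d e : D} (h : M.origin d = M.origin e)
    (ht : ∀ x, M.origin x = M.origin d → t (M.vertexPerm x) = t x) : t d = t e := by
  have hc : M.vertexPerm.SameCycle d e :=
    Quotient.exact (s := Equiv.Perm.SameCycle.setoid M.vertexPerm) h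
  obtain ⟨n, rfl⟩ := hc.exists_nat_pow_eq
  clear hc h
  induction n with
  | zero => rfl
  | succ n ih =>
    rw [pow_succ', Equiv.Perm.mul_apply, ht, ← ih]
    clear ih
    induction n with
    | zero => rfl
    | succ n ih => rw [pow_succ', Equiv.Perm.mul_apply, M.origin_vertexPerm, ih]

/-- The potential of a cycle on the whole sphere cannot change around a boundary vertex of `R`,
since all edges there carry coefficient zero. -/
theorem subsingleton_H₁_innerComplement (R : M.Region) :
    Subsingleton (M.innerComplement R).H₁ := by
  classical
  rw [Submodule.Quotient.subsingleton_iff, Submodule.submoduleOf_eq_top]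
  rintro f ⟨⟨hanti, hsupp⟩, hker⟩
  have hv : ∀ v, ∑ d, (if M.target d = v then f d else 0) = 0 := fun v => congrFun hker v
  have := Fintype.ofFinite M.Vertex
  have htarget : ∀ q : M.Vertex → ℚ, ∑ d, (f d : ℚ) * q (M.target d) = 0 := by
    intro q
    have h1 : ∀ v, ∑ d, (if M.target d = v then (f d : ℚ) * q v else 0) = 0 := by
      intro v
      have h2 : ((∑ d, (if M.target d = v then f d else 0) : ℤ) : ℚ) * q v = 0 := by
        rw [hv]
        simp
      refine Eq.trans ?_ h2
      rw [Int.cast_sum, Finset.sum_mul]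
      refine Finset.sum_congr rfl fun d _ => ?_
      by_cases hd : M.target d = v <;> simp [hd]
    have h3 : ∑ v, ∑ d, (if M.target d = v then (f d : ℚ) * q v else 0) = 0 :=
      Finset.sum_eq_zero fun v _ => h1 v
    rw [Finset.sum_comm] at h3
    simpa using h3
  obtain ⟨g, hg⟩ := M.exists_region_potential f hanti fun q => by
    rw [← neg_eq_zero, ← Finset.sum_neg_distrib, ← Equiv.sum_comp M.edgePerm, ← htarget q]
    refine Finset.sum_congr rfl fun d _ => ?_
    rw [hanti, target]
    push_cast
    ring
  -- Normalised to vanish at `R`; the sign is reversed because `g` gives right minus left, whereas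
  -- `boundary₂` is left minus right.
  refine ⟨fun F => g R - g F, fun F hF => ?_, funext fun d => ?_⟩
  · have hF' : ∃ d, M.region d = F ∧ M.origin d ∈ M.boundaryVertices R := by
      simpa [innerComplement] using hF
    obtain ⟨d, rfl, hd⟩ := hF'
    obtain ⟨a, rfl, had⟩ := hd
    refine sub_eq_zero.2 (M.eq_of_origin_eq (fun d => g (M.region d)) had fun x hx => ?_)
    have h0 : f (M.vertexPerm x) = 0 := by
      refine hsupp _ fun hx' => hx' _ rfl ?_
      exact ⟨a, rfl, by rw [M.origin_vertexPerm, hx]⟩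
    rw [hg, M.region_edgePerm_vertexPerm] at h0
    exact (sub_eq_zero.1 h0).symm
  · rw [hg]
    simp [boundary₂]

/-! ### Closed curves as potentials on edges. -/

open Classical in
/-- The characteristic function of an arc around a vertex. -/
theorem exists_arc {a b : D} (h : M.origin a = M.origin b) :
    ∃ p : D → ℤ, ∀ d, p (M.vertexPerm d) - p d =
      (if d = a then 1 else 0) - (if d = b then 1 else 0) := by
  have hc : M.vertexPerm.SameCycle a b :=
    Quotient.exact (s := Equiv.Perm.SameCycle.setoid M.vertexPerm) h
  obtain ⟨n, rfl⟩ := hc.exists_nat_pow_eq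
  clear hc h
  induction n with
  | zero => exact ⟨0, by simp⟩
  | succ n ih =>
    obtain ⟨p, hp⟩ := ih
    refine ⟨fun d => p d + if d = (M.vertexPerm ^ (n + 1)) a then 1 else 0, fun d => ?_⟩
    have h1 : M.vertexPerm d = (M.vertexPerm ^ (n + 1)) a ↔ d = (M.vertexPerm ^ n) a := by
      rw [pow_succ', Equiv.Perm.mul_apply, M.vertexPerm.injective.eq_iff]
    have h2 := hp d
    simp only [h1]
    linarith

/-- An increment function on the corners of the diagram that comes from a function around every
vertex and has vanishing sums around the faces is the increment of a function on edges. -/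
theorem exists_edge_potential (p : D → ℤ) (hp : ∀ g : M.Region → ℚ,
      ∑ d, ((p (M.vertexPerm d) - p d : ℤ) : ℚ) * g (M.region d) = 0) :
    ∃ h : D → ℤ, (∀ d, h (M.edgePerm d) = h d) ∧
      ∀ d, h (M.vertexPerm d) - h d = p (M.vertexPerm d) - p d := by
  -- The discrepancy of `p` between the two halves of an edge is a cocycle by `hp`; adding a
  -- constant at each vertex removes it without altering increments.
  obtain ⟨q, hq⟩ := M.exists_vertex_potential (fun d => p d - p (M.edgePerm d))
    (fun d => by rw [M.edgePerm_edgePerm]; ring) (fun g => by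
      have h1 : ∑ d, (p (M.edgePerm d) : ℚ) * g (M.region d) =
          ∑ d, (p (M.vertexPerm d) : ℚ) * g (M.region d) := by
        rw [← Equiv.sum_comp M.facePerm fun d => (p (M.vertexPerm d) : ℚ) * g (M.region d)]
        simp only [M.vertexPerm_facePerm, M.region_facePerm]
      have h2 := hp g
      push_cast at h2 ⊢
      simp only [sub_mul, Finset.sum_sub_distrib] at h2 ⊢
      linarith)
  refine ⟨fun d => p d + q (M.origin d), fun d => ?_, fun d => ?_⟩
  · have := hq d
    linarith
  · simp only [M.origin_vertexPerm]
    ring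

open Classical in
/-- A closed curve through two corners of a region at the same vertex. -/
theorem exists_potential_of_origin_eq {a b : D} (h : M.origin a = M.origin b)
    (hr : M.region a = M.region b) :
    ∃ h : D → ℤ, (∀ d, h (M.edgePerm d) = h d) ∧ ∀ d, h (M.vertexPerm d) - h d =
      (if d = a then 1 else 0) - (if d = b then 1 else 0) := by
  obtain ⟨p, hp⟩ := M.exists_arc h
  obtain ⟨h, h1, h2⟩ := M.exists_edge_potential p fun g => by
    simp [hp, sub_mul, Finset.sum_sub_distrib, hr]
  exact ⟨h, h1, fun d => by rw [h2, hp]⟩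

open Classical in
/-- A closed curve that traverses two regions and crosses the diagram in two vertices. -/
theorem exists_potential_of_region_eq {a a' b b' : D} (ha : M.origin a = M.origin a')
    (hb : M.origin b = M.origin b') (hab : M.region a = M.region b)
    (hab' : M.region a' = M.region b') :
    ∃ h : D → ℤ, (∀ d, h (M.edgePerm d) = h d) ∧ ∀ d, h (M.vertexPerm d) - h d =
      (if d = a then 1 else 0) - (if d = a' then 1 else 0) +
        ((if d = b' then 1 else 0) - (if d = b then 1 else 0)) := by
  obtain ⟨p, hp⟩ := M.exists_arc ha
  obtain ⟨p', hp'⟩ := M.exists_arc hb.symm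
  obtain ⟨h, h1, h2⟩ := M.exists_edge_potential (p + p') fun g => by
    have : ∀ d, (p + p') (M.vertexPerm d) - (p + p') d =
      (p (M.vertexPerm d) - p d) + (p' (M.vertexPerm d) - p' d) := fun d => by
        simp only [Pi.add_apply]
        ring
    simp only [this, hp, hp']
    simp [sub_mul, add_mul, Finset.sum_sub_distrib, Finset.sum_add_distrib,
      hab, hab']
  refine ⟨h, h1, fun d => ?_⟩
  rw [h2, ← hp, ← hp']
  simp only [Pi.add_apply]
  ring

/-- Outside the vertices of `S`, a function on edges without increments is constant, provided that
the diagram minus `S` is connected. -/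
theorem exists_const_of_connected {S : Set M.Vertex} (hS : (M.graph.induce Sᶜ).Connected)
    (h : D → ℤ) (he : ∀ d, h (M.edgePerm d) = h d)
    (hv : ∀ d, M.origin d ∉ S → h (M.vertexPerm d) = h d) :
    ∃ k, ∀ d, M.origin d ∉ S → h d = k := by
  have hvert : ∀ d e, M.origin d = M.origin e → M.origin d ∉ S → h d = h e :=
    fun d e hde hd => M.eq_of_origin_eq h hde fun x hx => hv x (hx ▸ hd)
  have key : ∀ x y : (Sᶜ : Set M.Vertex), (M.graph.induce Sᶜ).Walk x y →
      ∀ d e, M.origin d = x → M.origin e = y → h d = h e := by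
    intro x y w
    induction w with
    | @nil x => exact fun d e hd he' => hvert d e (hd.trans he'.symm) (hd ▸ x.2)
    | @cons x y z hadj w ih =>
      intro d e hd he'
      obtain ⟨-, c, hc, hc'⟩ := hadj
      rw [hvert d c (hd.trans hc.symm) (hd ▸ x.2), ← he c]
      exact ih _ e hc' he'
  obtain ⟨⟨x, hx⟩⟩ := hS.nonempty
  obtain ⟨c, rfl⟩ := M.origin_surjective x
  refine ⟨h c, fun d hd => ?_⟩
  obtain ⟨w⟩ := hS.preconnected ⟨_, hd⟩ ⟨_, hx⟩
  exact key _ _ w d c rfl rfl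

theorem vertexPerm_four (d : D) :
    M.vertexPerm (M.vertexPerm (M.vertexPerm (M.vertexPerm d))) = d ∧
      M.vertexPerm d ≠ d ∧ M.vertexPerm (M.vertexPerm d) ≠ d := by
  have h1 : Function.minimalPeriod M.vertexPerm d = 4 := by
    have := Fintype.ofFinite (MulAction.orbit (Subgroup.zpowers M.vertexPerm) d)
    have h2 := MulAction.minimalPeriod_eq_card (a := M.vertexPerm) (b := d)
    rw [← Nat.card_eq_fintype_card, Nat.card_coe_set_eq] at h2
    refine h2.trans ?_
    rw [← M.fourValent d]
    congr 1
    ext e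
    simp [MulAction.mem_orbit_iff, Equiv.Perm.SameCycle]
    exact Iff.rfl
  refine ⟨?_, fun h => ?_, fun h => ?_⟩
  · have := Function.iterate_minimalPeriod (f := M.vertexPerm) (x := d)
    rwa [h1] at this
  · have := Function.IsPeriodicPt.minimalPeriod_dvd (f := M.vertexPerm) (n := 1) (x := d) h
    rw [h1] at this
    omega
  · have := Function.IsPeriodicPt.minimalPeriod_dvd (f := M.vertexPerm) (n := 2) (x := d) h
    rw [h1] at this
    omega

end DoodleDiagram

/-! ### Consequences of 3-connectedness at a single vertex. -/

namespace DoodleDiagram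

variable {D : Type*} [Fintype D] {M : DoodleDiagram D}

theorem eq_of_origin_eq_origin {a d : D} (h : M.origin d = M.origin a) :
    d = a ∨ d = M.vertexPerm a ∨ d = M.vertexPerm (M.vertexPerm a) ∨
      d = M.vertexPerm (M.vertexPerm (M.vertexPerm a)) := by
  have hc : M.vertexPerm.SameCycle a d :=
    Quotient.exact (s := Equiv.Perm.SameCycle.setoid M.vertexPerm) h.symm
  obtain ⟨n, rfl⟩ := hc.exists_nat_pow_eq
  clear hc h
  induction n with
  | zero => exact Or.inl rfl
  | succ n ih =>
    rw [pow_succ', Equiv.Perm.mul_apply]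
    have := (M.vertexPerm_four a).1
    rcases ih with h | h | h | h <;> rw [h] <;> simp [this]

variable (M) in
theorem vertexPerm_three_ne (a : D) : M.vertexPerm (M.vertexPerm (M.vertexPerm a)) ≠ a := by
  intro h
  have h4 := (M.vertexPerm_four a).1
  rw [h] at h4
  exact (M.vertexPerm_four a).2.1 h4

/-- Otherwise deleting `x` and `y` would isolate `u` from a fourth vertex. -/
theorem IsPrime.exists_dart (hM : M.IsPrime) (u x y : M.Vertex) :
    ∃ d, M.origin d = u ∧ M.target d ≠ u ∧ M.target d ≠ x ∧ M.target d ≠ y := by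
  classical
  have := Fintype.ofFinite M.Vertex
  -- `u` may coincide with `x` or `y` and must not be deleted.
  let S : Set M.Vertex := {x, y} \ {u}
  have hS : S.ncard < 3 := by
    have h1 : S.ncard ≤ ({x, y} : Set M.Vertex).ncard :=
      Set.ncard_le_ncard Set.sdiff_subset (Set.toFinite _)
    have h2 := Set.ncard_insert_le x {y}
    rw [Set.ncard_singleton] at h2
    omega
  have hu : u ∈ Sᶜ := by simp [S]
  obtain ⟨w, hw⟩ : ∃ w, w ∉ ({u, x, y} : Finset M.Vertex) := by
    by_contra! hc
    have h1 : (Finset.univ : Finset M.Vertex).card ≤ _ :=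
      Finset.card_le_card fun v _ => hc v
    have h2 := Finset.card_le_three (a := u) (b := x) (c := y)
    have h3 := hM.1
    rw [Nat.card_eq_fintype_card, ← Finset.card_univ] at h3
    omega
  simp only [Finset.mem_insert, Finset.mem_singleton, not_or] at hw
  have hwS : w ∈ Sᶜ := by simp [S, hw.2.1, hw.2.2]
  obtain ⟨p⟩ := (hM.2 S hS).preconnected ⟨u, hu⟩ ⟨w, hwS⟩
  cases p with
  | nil => exact absurd rfl hw.1
  | @cons _ z _ hadj _ =>
    obtain ⟨hne, d, hd, hd'⟩ := hadj
    change u ≠ z at hne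
    change M.origin d = u at hd
    change M.target d = z at hd'
    have hz : (z : M.Vertex) ∉ S := z.2
    simp only [S, Set.mem_sdiff, Set.mem_insert_iff, Set.mem_singleton_iff, not_and, not_not] at hz
    refine ⟨d, hd, hd' ▸ hne.symm, fun h => ?_, fun h => ?_⟩
    · exact hne (hz (Or.inl (hd' ▸ h))).symm
    · exact hne (hz (Or.inr (hd' ▸ h))).symm

/-- A loop uses two of the four darts at its vertex, so deleting the ends of the other two would
isolate that vertex. -/
theorem IsPrime.target_ne_origin (hM : M.IsPrime) (a : D) : M.target a ≠ M.origin a := by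
  intro h
  have h4 := M.vertexPerm_four a
  have hne := M.edgePerm_ne a
  have key : ∀ x y : D, (∀ d, M.origin d = M.origin a →
      d = a ∨ d = M.edgePerm a ∨ d = x ∨ d = y) → False := by
    intro x y hxy
    obtain ⟨d, hd, hd1, hd2, hd3⟩ := hM.exists_dart (M.origin a) (M.target x) (M.target y)
    rcases hxy d hd with rfl | rfl | rfl | rfl
    · exact hd1 h
    · exact hd1 (by rw [target, M.edgePerm_edgePerm])
    · exact hd2 rfl
    · exact hd3 rfl
  rcases eq_of_origin_eq_origin (a := a) (d := M.edgePerm a) h with h1 | h1 | h1 | h1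
  · exact hne h1
  · refine key (M.vertexPerm (M.vertexPerm a))
      (M.vertexPerm (M.vertexPerm (M.vertexPerm a))) fun d hd => ?_
    rw [h1]
    exact eq_of_origin_eq_origin hd
  · refine key (M.vertexPerm a) (M.vertexPerm (M.vertexPerm (M.vertexPerm a))) fun d hd => ?_
    rw [h1]
    rcases eq_of_origin_eq_origin hd with h | h | h | h
    · exact Or.inl h
    · exact Or.inr (Or.inr (Or.inl h))
    · exact Or.inr (Or.inl h)
    · exact Or.inr (Or.inr (Or.inr h))
  · refine key (M.vertexPerm a) (M.vertexPerm (M.vertexPerm a)) fun d hd => ?_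
    rw [h1]
    rcases eq_of_origin_eq_origin hd with h | h | h | h
    · exact Or.inl h
    · exact Or.inr (Or.inr (Or.inl h))
    · exact Or.inr (Or.inr (Or.inr h))
    · exact Or.inr (Or.inl h)

/-- A region has at most one corner at every vertex. -/
theorem IsPrime.eq_of_region_eq (hM : M.IsPrime) {a b : D} (h : M.origin a = M.origin b)
    (hr : M.region a = M.region b) : a = b := by
  classical
  by_contra hab
  obtain ⟨f, hf, hinc⟩ := M.exists_potential_of_origin_eq h hr
  obtain ⟨k, hk⟩ := M.exists_const_of_connected (S := {M.origin a}) (hM.2 _ (by simp)) f hf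
    fun d hd => by
      have h1 : d ≠ a := fun h => hd (h ▸ rfl)
      have h2 : d ≠ b := fun h' => hd (h' ▸ h.symm)
      have := hinc d
      rw [if_neg h1, if_neg h2] at this
      linarith
  -- Without loops every edge has an end other than the deleted vertex, so the potential is constant
  -- on all edges and cannot jump at `a`.
  have hk' : ∀ d, f d = k := by
    intro d
    by_cases hd : M.origin d = M.origin a
    · rw [← hf]
      exact hk _ fun h' => hM.target_ne_origin d (h'.trans hd.symm)
    · exact hk _ hd
  have := hinc a
  rw [if_pos rfl, if_neg hab, hk', hk'] at this
  simp at this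

theorem IsPrime.region_vertexPerm_ne (hM : M.IsPrime) (d : D) :
    M.region (M.vertexPerm d) ≠ M.region d := fun h =>
  (M.vertexPerm_four d).2.1 (hM.eq_of_region_eq (M.origin_vertexPerm d) h)

theorem IsMinimal.facePerm_facePerm_ne (hM : M.IsMinimal) (d : D) :
    M.facePerm (M.facePerm d) ≠ d := by
  intro h
  have h1 : {e | M.region e = M.region d} = {d, M.facePerm d} := by
    ext e
    constructor
    · intro he
      have hc : M.facePerm.SameCycle d e :=
        Quotient.exact (s := Equiv.Perm.SameCycle.setoid M.facePerm) he.symm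
      obtain ⟨n, rfl⟩ := hc.exists_nat_pow_eq
      clear he hc
      induction n with
      | zero => exact Or.inl rfl
      | succ n ih =>
        rw [pow_succ', Equiv.Perm.mul_apply]
        rcases ih with h' | h' <;> rw [h']
        · exact Or.inr rfl
        · exact Or.inl h
    · rintro (rfl | rfl)
      · rfl
      · exact M.region_facePerm d
  have h2 := hM (M.region d)
  rw [boundaryLength, h1] at h2
  by_cases h3 : d = M.facePerm d
  · rw [← h3] at h2
    simp at h2
  · rw [Set.ncard_pair h3] at h2
    exact h2.2 rfl

open Classical in
/-- At a vertex `u` all of whose neighbours but `v` are reached through edges with value `k`, the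
edges of a nonempty arc with value `k + 1` lead to `v`, and there are at most two of them. -/
theorem IsPrime.arc_cases (hM : M.IsPrime) {a a' : D} {v : M.Vertex} {h : D → ℤ} {k : ℤ}
    (ha : M.origin a' = M.origin a) (hne : a ≠ a')
    (hinc : ∀ d, M.origin d = M.origin a → h (M.vertexPerm d) - h d =
      (if d = a then 1 else 0) - (if d = a' then 1 else 0))
    (hout : ∀ d, M.origin d = M.origin a → M.target d ≠ v → h d = k)
    (hex : ∃ d, M.origin d = M.origin a ∧ h d = k + 1) :
    h a' = k + 1 ∧
      ((a' = M.vertexPerm a ∧ ∀ d, M.origin d = M.origin a → h d = k + 1 → d = a') ∨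
      (a' = M.vertexPerm (M.vertexPerm a) ∧ h (M.vertexPerm a) = k + 1 ∧
        ∀ d, M.origin d = M.origin a → h d = k + 1 → d = a' ∨ d = M.vertexPerm a)) := by
  obtain ⟨d₀, hd₀, hk₀⟩ := hex
  -- Avoiding also the end of `a` yields a dart of value `k` other than `a`, which rules out an arc
  -- of three darts.
  obtain ⟨d₁, hd₁, -, hk₁, hk₁'⟩ := hM.exists_dart (M.origin a) v (M.target a)
  replace hk₁ := hout d₁ hd₁ hk₁
  have hda : d₁ ≠ a := fun h => hk₁' (h ▸ rfl)
  obtain ⟨h4, h1, h2⟩ := M.vertexPerm_four a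
  have h3 := (M.vertexPerm_four (M.vertexPerm a)).2.2
  have o1 := M.origin_vertexPerm a
  have o2 := (M.origin_vertexPerm (M.vertexPerm a)).trans o1
  have o3 := (M.origin_vertexPerm (M.vertexPerm (M.vertexPerm a))).trans o2
  have h5 := M.vertexPerm_three_ne a
  have i0 := hinc _ rfl
  have i1 := hinc _ o1
  have i2 := hinc _ o2
  have c0 := eq_of_origin_eq_origin hd₀
  have c1 := eq_of_origin_eq_origin hd₁
  rw [or_iff_right hda] at c1
  rcases eq_of_origin_eq_origin ha with rfl | rfl | rfl | rfl
  · exact absurd rfl hne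
  · simp [h1, h2, h1.symm] at i0 i1 i2
    have hk : h a = k := by
      rcases c0 with rfl | rfl | rfl | rfl <;> rcases c1 with rfl | rfl | rfl <;> omega
    refine ⟨by omega, Or.inl ⟨rfl, fun d hd hdk => ?_⟩⟩
    rcases eq_of_origin_eq_origin hd with rfl | rfl | rfl | rfl <;> first | rfl | omega
  · simp [h1, h2, h1.symm, h2.symm] at i0 i1 i2
    have hk : h a = k := by
      rcases c0 with rfl | rfl | rfl | rfl <;> rcases c1 with rfl | rfl | rfl <;> omega
    refine ⟨by omega, Or.inr ⟨rfl, by omega, fun d hd hdk => ?_⟩⟩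
    rcases eq_of_origin_eq_origin hd with rfl | rfl | rfl | rfl <;>
      first | exact Or.inl rfl | exact Or.inr rfl | omega
  · simp [h1, h1.symm, h2, h3.symm, h5.symm] at i0 i1 i2
    rcases c0 with rfl | rfl | rfl | rfl <;> rcases c1 with rfl | rfl | rfl <;> omega

end DoodleDiagram

/-! ### Regions with two common vertices. -/

namespace DoodleDiagram

variable {D : Type*} [Fintype D] {M : DoodleDiagram D}

theorem facePerm_eq_of_edgePerm_eq {x y : D} (h : M.edgePerm x = M.vertexPerm y) :
    M.facePerm x = y :=
  M.vertexPerm.injective ((M.vertexPerm_facePerm x).trans h)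

-- The edges of value `k + 1` all join the two vertices, and at each end they form an arc of one or
-- two darts. Matching the ends forces equal numbers, and two such edges would either enclose a
-- bigon or make the two regions equal. The single remaining edge is the common one.
open Classical in
theorem common_edge_of_potential (hM : M.IsPrime) (hmin : M.IsMinimal) {a a' b b' : D}
    (ha : M.origin a' = M.origin a) (hb : M.origin b' = M.origin b)
    (hv : M.origin b ≠ M.origin a) (hr : M.region a ≠ M.region a')
    (hab : M.region a = M.region b) (hab' : M.region a' = M.region b') {h : D → ℤ} {k : ℤ}
    (hh : ∀ d, h (M.edgePerm d) = h d)
    (hinc : ∀ d, h (M.vertexPerm d) - h d = (if d = a then 1 else 0) - (if d = a' then 1 else 0) +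
        ((if d = b' then 1 else 0) - (if d = b then 1 else 0)))
    (hout : ∀ d, M.origin d ≠ M.origin a → M.origin d ≠ M.origin b → h d = k)
    (hex : ∃ d, M.origin d = M.origin a ∧ h d = k + 1) :
    a' = M.vertexPerm a ∧ M.edgePerm a' = b ∧ b = M.vertexPerm b' := by
  have hne : ∀ d e, M.origin d = M.origin a → M.origin e = M.origin b → d ≠ e :=
    fun d e hd he hde => hv (he.symm.trans (hde ▸ hd))
  have hba : ∀ d, M.origin d = M.origin a → M.target d ≠ M.origin b → h d = k :=
    fun d hd hdb => hh d ▸ hout _ (fun h' => hM.target_ne_origin d (h'.trans hd.symm)) hdb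
  have hbb : ∀ d, M.origin d = M.origin b → M.target d ≠ M.origin a → h d = k :=
    fun d hd hda => hh d ▸ hout _ hda (fun h' => hM.target_ne_origin d (h'.trans hd.symm))
  have A := hM.arc_cases (v := M.origin b) (h := h) (k := k) ha (fun h => hr (h ▸ rfl))
    (fun d hd => by rw [hinc, if_neg (hne d b' hd hb), if_neg (hne d b hd rfl), sub_self,
      add_zero]) hba hex
  have htarget : ∀ d, M.origin d = M.origin a → h d = k + 1 → M.target d = M.origin b := by
    intro d hd hdk
    by_contra hc
    have := hba d hd hc
    omega
  have ob : M.origin (M.edgePerm a') = M.origin b' := (htarget a' ha A.1).trans hb.symm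
  have ka := (hh a').trans A.1
  have B := hM.arc_cases (a := b') (a' := b) (v := M.origin a) (h := h) (k := k) hb.symm
    (fun h => hr (by rw [hab, hab', h]))
    (fun d hd => by
      rw [hinc, if_neg (hne a d rfl (hd.trans hb)).symm, if_neg (hne a' d ha (hd.trans hb)).symm,
        sub_self, zero_add])
    (fun d hd => hbb d (hd.trans hb)) ⟨M.edgePerm a', ob, ka⟩
  obtain ⟨hk, A⟩ := A
  obtain ⟨hk', B⟩ := B
  have hα := M.edgePerm.injective
  rcases A with ⟨A1, A2⟩ | ⟨A1, A2, A3⟩ <;> rcases B with ⟨B1, B2⟩ | ⟨B1, B2, B3⟩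
  · exact ⟨A1, B2 _ ob ka, B1⟩
  · exfalso
    have tb : ∀ d, M.origin d = M.origin b → h d = k + 1 → M.edgePerm d = a' := by
      intro d hd hdk
      refine A2 _ ?_ ((hh d).trans hdk)
      by_contra hc
      have := hbb d hd hc
      omega
    have h1 := tb b rfl hk'
    have h2 := tb (M.vertexPerm b') ((M.origin_vertexPerm b').trans hb) B2
    have h3 := hα (h1.trans h2.symm)
    rw [B1] at h3
    exact (M.vertexPerm_four _).2.1 h3
  · exfalso
    have ox := M.origin_vertexPerm a
    have h1 := B2 _ ob ka
    have h2 := B2 (M.edgePerm (M.vertexPerm a)) ((htarget _ ox A2).trans hb.symm)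
      ((hh _).trans A2)
    have h3 := hα (h1.trans h2.symm)
    rw [A1] at h3
    exact (M.vertexPerm_four _).2.1 h3
  · exfalso
    have ox := M.origin_vertexPerm a
    have h1 := B3 _ ob ka
    have h2 := B3 (M.edgePerm (M.vertexPerm a)) ((htarget _ ox A2).trans hb.symm)
      ((hh _).trans A2)
    set x := M.vertexPerm a with hx
    set y := M.vertexPerm b' with hy
    have hxa : M.edgePerm a' ≠ M.edgePerm x := fun h3 => by
      have h3 := hα h3
      rw [A1] at h3
      exact (M.vertexPerm_four _).2.1 h3
    -- Two edges, each matched to one of `b`, `y`: one bijection puts `a` and `a'` on one face, the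
    -- other closes a bigon.
    rcases h1 with h1 | h1 <;> rcases h2 with h2 | h2
    · exact hxa (h1.trans h2.symm)
    · have e1 : M.facePerm a' = y := facePerm_eq_of_edgePerm_eq (h1.trans B1)
      have e2 : M.facePerm y = a := facePerm_eq_of_edgePerm_eq (by
        rw [← h2, M.edgePerm_edgePerm])
      exact hr (by rw [← e2, ← e1, M.region_facePerm, M.region_facePerm])
    · have e1 : M.facePerm x = y := facePerm_eq_of_edgePerm_eq (h2.trans B1)
      have e2 : M.facePerm y = x := facePerm_eq_of_edgePerm_eq (by
        rw [← h1, M.edgePerm_edgePerm, A1])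
      exact hmin.facePerm_facePerm_ne x (e1 ▸ e2)
    · exact hxa (h1.trans h2.symm)

/-- Two regions that share two vertices share an edge between these vertices. -/
theorem common_edge (hM : M.IsPrime) (hmin : M.IsMinimal) {a a' b b' : D}
    (ha : M.origin a' = M.origin a) (hb : M.origin b' = M.origin b)
    (hv : M.origin b ≠ M.origin a) (hr : M.region a ≠ M.region a')
    (hab : M.region a = M.region b) (hab' : M.region a' = M.region b') :
    (a' = M.vertexPerm a ∧ M.edgePerm a' = b ∧ b = M.vertexPerm b') ∨
      (a = M.vertexPerm a' ∧ M.edgePerm a = b' ∧ b' = M.vertexPerm b) := by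
  classical
  obtain ⟨h, hh, hinc⟩ := M.exists_potential_of_region_eq ha.symm hb.symm hab hab'
  obtain ⟨k, hk⟩ := M.exists_const_of_connected (S := {M.origin a, M.origin b})
    (hM.2 _ (by rw [Set.ncard_pair hv.symm]; norm_num)) h hh fun d hd => by
      simp only [Set.mem_insert_iff, Set.mem_singleton_iff, not_or] at hd
      have h1 : d ≠ a := fun h => hd.1 (h ▸ rfl)
      have h2 : d ≠ a' := fun h' => hd.1 (h' ▸ ha)
      have h3 : d ≠ b := fun h => hd.2 (h ▸ rfl)
      have h4 : d ≠ b' := fun h' => hd.2 (h' ▸ hb)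
      have := hinc d
      rw [if_neg h1, if_neg h2, if_neg h3, if_neg h4] at this
      linarith
  replace hk : ∀ d, M.origin d ≠ M.origin a → M.origin d ≠ M.origin b → h d = k :=
    fun d h1 h2 => hk d (by simp [h1, h2])
  have hi := hinc a
  have n1 : a ≠ a' := fun h => hr (h ▸ rfl)
  have n2 : a ≠ b := fun h => hv (h ▸ rfl)
  have n3 : a ≠ b' := fun h => hv (hb ▸ h ▸ rfl)
  rw [if_pos rfl, if_neg n1, if_neg n2, if_neg n3] at hi
  have oa := M.origin_vertexPerm a
  by_cases hka : h (M.vertexPerm a) = k + 1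
  · exact Or.inl (common_edge_of_potential hM hmin ha hb hv hr hab hab' hh hinc hk ⟨_, oa, hka⟩)
  -- The other side of the curve is then the one of value `k - 1`; negating the potential and
  -- exchanging the two regions reduces it to the first case.
  · refine Or.inr (common_edge_of_potential hM hmin (a := a') (a' := a) (b := b') (b' := b)
      (h := fun d => -h d) (k := -k) ha.symm hb.symm (ha ▸ hb ▸ hv) hr.symm hab' hab
      (fun d => by rw [hh]) (fun d => by linarith [hinc d])
      (fun d h1 h2 => by rw [hk d (ha ▸ h1) (hb ▸ h2)]) ⟨a, ha.symm, ?_⟩)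
    have h4 := (M.vertexPerm_four a).1
    obtain ⟨d, hd, -, hdb, -⟩ := hM.exists_dart (M.origin a) (M.origin b) (M.origin b)
    have hdk : h d = k := by
      rw [← hh]
      exact hk _ (fun h' => hM.target_ne_origin d (h'.trans hd.symm)) hdb
    have hstep : ∀ x, M.origin x = M.origin a → x ≠ a →
        h (M.vertexPerm x) - h x = -(if x = a' then 1 else 0) := by
      intro x hx hxa
      have m1 : x ≠ b := fun h => hv (h ▸ hx)
      have m2 : x ≠ b' := fun h => hv (hb ▸ h ▸ hx)
      rw [hinc, if_neg hxa, if_neg m1, if_neg m2]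
      ring
    have o2 := (M.origin_vertexPerm (M.vertexPerm a)).trans oa
    have s1 := hstep _ oa (M.vertexPerm_four a).2.1
    have s2 := hstep _ o2 (M.vertexPerm_four a).2.2
    have s3 := hstep _ ((M.origin_vertexPerm _).trans o2) (M.vertexPerm_three_ne a)
    rw [h4] at s3
    rcases eq_of_origin_eq_origin hd with rfl | rfl | rfl | rfl <;>
      split_ifs at s1 s2 s3 <;> omega

/-- If `R` is not on the left of `d`, it shares both ends of `d` with the region there, hence an
edge: either that edge is `d`, or it bounds a bigon with `d`. -/
theorem edgePerm_mem_of_chord (hM : M.IsPrime) (hmin : M.IsMinimal) {R : M.Region} {d : D}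
    (h1 : M.origin d ∈ M.boundaryVertices R) (h2 : M.target d ∈ M.boundaryVertices R) :
    M.region d = R ∨ M.region (M.edgePerm d) = R := by
  obtain ⟨a, rfl, ha⟩ := h1
  obtain ⟨b, hab, hb⟩ := h2
  by_contra! hc
  have hv : M.origin b ≠ M.origin a := by
    rw [ha, hb]
    exact hM.target_ne_origin d
  rcases common_edge hM hmin (a := a) (a' := d) (b := b) (b' := M.facePerm d) ha.symm
    ((M.origin_facePerm d).trans hb.symm) hv hc.1.symm hab.symm (M.region_facePerm d).symm with
    ⟨-, h, -⟩ | ⟨h, h', -⟩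
  · exact hc.2 (by rw [h, hab])
  · refine hmin.facePerm_facePerm_ne d ?_
    rw [← h', h, facePerm_edgePerm_vertexPerm]

/-- A region cannot be met by three consecutive edges from a vertex outside its boundary. -/
theorem not_three_consecutive (hM : M.IsPrime) (hmin : M.IsMinimal) {R : M.Region} {d : D}
    (hd : M.origin d ∉ M.boundaryVertices R) (h0 : M.target d ∈ M.boundaryVertices R)
    (h1 : M.target (M.vertexPerm d) ∈ M.boundaryVertices R)
    (h2 : M.target (M.vertexPerm (M.vertexPerm d)) ∈ M.boundaryVertices R) : False := by
  have key : ∀ x, M.origin x = M.origin d → M.target x ∈ M.boundaryVertices R →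
      M.target (M.vertexPerm x) ∈ M.boundaryVertices R →
      ∃ a b, M.region a = R ∧ M.region b = R ∧ M.facePerm x = M.vertexPerm a ∧
        b = M.vertexPerm (M.edgePerm (M.vertexPerm x)) := by
    rintro x hx ⟨a, har, hao⟩ ⟨b, hbr, hbo⟩
    have hxR : M.region x ≠ R := fun h => hd ⟨x, h, hx⟩
    have hface := M.facePerm_edgePerm_vertexPerm x
    have hreg := M.region_edgePerm_vertexPerm x
    have hv : M.origin b ≠ M.origin a := by
      rw [hao, hbo]
      intro h
      have := hM.eq_of_region_eq (a := M.edgePerm (M.vertexPerm x)) (b := M.facePerm x)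
        (h.trans (M.origin_facePerm x).symm) (hreg.trans (M.region_facePerm x).symm)
      exact hmin.facePerm_facePerm_ne x (this ▸ hface)
    rcases common_edge hM hmin (a := a) (a' := M.facePerm x) (b := b)
      (b' := M.edgePerm (M.vertexPerm x)) ((M.origin_facePerm x).trans hao.symm) hbo.symm hv
      (by rw [har, M.region_facePerm]; exact hxR.symm) (har.trans hbr.symm)
      ((M.region_facePerm x).trans hreg.symm) with ⟨h, -, h'⟩ | ⟨-, h, h'⟩
    · exact ⟨a, b, har, hbr, h, h'⟩
    -- Here the common edge would start at the vertex of `d`, which is off the boundary of `R`.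
    · exact absurd ⟨a, har, by rw [M.edgePerm.injective h, M.origin_vertexPerm, hx]⟩ hd
  obtain ⟨a, b, -, hb, -, hb'⟩ := key d rfl h0 h1
  obtain ⟨a₂, b₂, ha, -, ha', -⟩ := key (M.vertexPerm d) (M.origin_vertexPerm d) h1 h2
  have h3 : M.edgePerm (M.vertexPerm d) = M.vertexPerm (M.vertexPerm a₂) := by
    rw [← ha', M.vertexPerm_facePerm]
  rw [h3] at hb'
  -- At the end of the middle edge the corner of `R` comes right after that edge and also two steps
  -- before it; as there is only one corner, three steps would close up around a vertex of valency
  -- four.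
  have h4 : b = a₂ := hM.eq_of_region_eq (by
    rw [hb', M.origin_vertexPerm, M.origin_vertexPerm, M.origin_vertexPerm]) (hb.trans ha.symm)
  have := (M.vertexPerm_four a₂).1
  rw [← hb', h4] at this
  exact (M.vertexPerm_four a₂).2.1 this

end DoodleDiagram

/-! ### Counting regions, vertices and inward edges. -/

theorem Fintype.card_eq_mul_of_fibers {D X : Type*} [Fintype D] [Finite X] {f : D → X} {k : ℕ}
    (hf : Function.Surjective f) (h : ∀ d, {e | f e = f d}.ncard = k) :
    Fintype.card D = Nat.card X * k := by
  classical
  have := Fintype.ofFinite X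
  rw [← Finset.card_univ, Finset.card_eq_sum_card_fiberwise (f := f) (t := Finset.univ)
    (fun _ _ => Finset.mem_coe.2 (Finset.mem_univ _)),
    Finset.sum_const_nat (m := k), Finset.card_univ, Nat.card_eq_fintype_card]
  intro x _
  obtain ⟨d, rfl⟩ := hf x
  rw [← h d, ← Set.ncard_coe_finset]
  congr 1
  ext e
  simp

namespace DoodleDiagram

variable {D : Type*} [Fintype D] (M : DoodleDiagram D)

theorem ncard_origin_eq (d : D) : {e | M.origin e = M.origin d}.ncard = 4 := by
  rw [← M.fourValent d]
  congr 1
  ext e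
  exact eq_comm.trans (Quotient.eq (r := Equiv.Perm.SameCycle.setoid M.vertexPerm))

theorem ncard_edge_eq (d : D) : {e | M.edge e = M.edge d}.ncard = 2 := by
  have : {e | M.edge e = M.edge d} = {d, M.edgePerm d} := by
    ext e
    constructor
    · exact fun h => eq_or_eq_of_edge_eq h.symm
    · rintro (rfl | rfl)
      · rfl
      · exact M.edge_edgePerm d
  rw [this, Set.ncard_pair (M.edgePerm_ne d).symm]

theorem card_region_eq : Nat.card M.Region = Nat.card M.Vertex + 2 := by
  have h1 := Fintype.card_eq_mul_of_fibers M.origin_surjective M.ncard_origin_eq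
  have h2 := Fintype.card_eq_mul_of_fibers M.edge_surjective M.ncard_edge_eq
  have h3 := M.card_vertex_add_card_region
  omega

variable {M}

/-- If every region meets the boundary of the `n`-gon `R`, there are at most `2 * n + 1` regions. -/
theorem card_region_le {R : M.Region}
    (hR : ∀ F, ∃ d, M.region d = F ∧ M.origin d ∈ M.boundaryVertices R) :
    Nat.card M.Region ≤ 2 * M.boundaryLength R + 1 := by
  have hsub : (Set.univ : Set M.Region) ⊆
      {R} ∪ ((fun a => M.region (M.edgePerm a)) '' {a | M.region a = R} ∪
        (fun a => M.region (M.vertexPerm (M.vertexPerm a))) '' {a | M.region a = R}) := by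
    rintro F -
    obtain ⟨d, rfl, a, ha, hda⟩ := hR F
    -- The four corners at a boundary vertex belong to `R`, to the neighbours across its two edges
    -- there, and to the region opposite.
    rcases eq_of_origin_eq_origin hda.symm with rfl | rfl | rfl | rfl
    · exact Or.inl ha
    · refine Or.inr (Or.inl ⟨M.facePerm.symm a, ?_, ?_⟩)
      · rw [Set.mem_ofPred_eq, ← M.region_facePerm, Equiv.apply_symm_apply, ha]
      · simp only [← M.vertexPerm_facePerm, Equiv.apply_symm_apply]
    · exact Or.inr (Or.inr ⟨a, ha, rfl⟩)
    · refine Or.inr (Or.inl ⟨a, ha, ?_⟩)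
      have := M.region_edgePerm_vertexPerm (M.vertexPerm (M.vertexPerm (M.vertexPerm a)))
      rwa [(M.vertexPerm_four a).1] at this
  have h1 := Set.ncard_le_ncard hsub (Set.toFinite _)
  rw [Set.ncard_univ] at h1
  have h2 := Set.ncard_union_le {R} ((fun a => M.region (M.edgePerm a)) '' {a | M.region a = R} ∪
        (fun a => M.region (M.vertexPerm (M.vertexPerm a))) '' {a | M.region a = R})
  have h3 := Set.ncard_union_le ((fun a => M.region (M.edgePerm a)) '' {a | M.region a = R})
        ((fun a => M.region (M.vertexPerm (M.vertexPerm a))) '' {a | M.region a = R})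
  have h4 := Set.ncard_image_le (f := fun a => M.region (M.edgePerm a))
    (Set.toFinite {a | M.region a = R})
  have h5 := Set.ncard_image_le (f := fun a => M.region (M.vertexPerm (M.vertexPerm a)))
    (Set.toFinite {a | M.region a = R})
  rw [Set.ncard_singleton] at h2
  rw [boundaryLength]
  omega

theorem IsPrime.ncard_boundaryVertices (hM : M.IsPrime) (R : M.Region) :
    (M.boundaryVertices R).ncard = M.boundaryLength R := by
  rw [boundaryLength, ← Set.InjOn.ncard_image (f := M.origin) (s := {d | M.region d = R})]
  · rfl
  · exact fun a ha b hb h => hM.eq_of_region_eq h (ha.trans hb.symm)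

/-- The darts that lead from the outside to the boundary of `R`. -/
def inwardDarts (R : M.Region) : Set D :=
  {d | M.origin d ∉ M.boundaryVertices R ∧ M.target d ∈ M.boundaryVertices R}

/-- Each corner of `R` leaves two darts off its boundary; they lead outside because there are no
chords. -/
theorem two_mul_boundaryLength_le (hM : M.IsPrime) (hmin : M.IsMinimal) (R : M.Region) :
    2 * M.boundaryLength R ≤ (inwardDarts R).ncard := by
  have hmem : ∀ a d, M.region a = R → M.origin d = M.origin a → M.region d ≠ R →
      M.region (M.edgePerm d) ≠ R → M.edgePerm d ∈ inwardDarts R := by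
    intro a d ha hd h1 h2
    have hb : M.origin d ∈ M.boundaryVertices R := ⟨a, ha, hd.symm⟩
    refine ⟨fun h => ?_, by rwa [target, M.edgePerm_edgePerm]⟩
    rcases edgePerm_mem_of_chord hM hmin hb h with h | h
    · exact h1 h
    · exact h2 h
  have hne : ∀ a d, M.region a = R → M.origin d = M.origin a → d ≠ a → M.region d ≠ R :=
    fun a d ha hd hda h => hda (hM.eq_of_region_eq hd (h.trans ha.symm))
  let f : D → D := fun a => M.edgePerm (M.vertexPerm (M.vertexPerm a))
  let g : D → D := fun a => M.edgePerm (M.vertexPerm (M.vertexPerm (M.vertexPerm a)))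
  have hsub : f '' {a | M.region a = R} ∪ g '' {a | M.region a = R} ⊆ inwardDarts R := by
    rintro _ (⟨a, ha, rfl⟩ | ⟨a, ha, rfl⟩) <;>
    · obtain ⟨-, n1, n2⟩ := M.vertexPerm_four a
      refine hmem a _ ha (by simp only [M.origin_vertexPerm]) ?_ ?_
      · refine hne a _ ha (by simp only [M.origin_vertexPerm]) ?_
        first | exact n2 | exact M.vertexPerm_three_ne a
      · rw [M.region_edgePerm_vertexPerm]
        refine hne a _ ha (by simp only [M.origin_vertexPerm]) ?_
        first | exact n1 | exact n2
  -- A coincidence would give `R` two adjacent corners at one vertex.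
  have hdisj : Disjoint (f '' {a | M.region a = R}) (g '' {a | M.region a = R}) := by
    rw [Set.disjoint_left]
    rintro _ ⟨a, ha, rfl⟩ ⟨b, hb, h⟩
    have h1 := M.vertexPerm.injective (M.vertexPerm.injective (M.edgePerm.injective h))
    refine hM.region_vertexPerm_ne b ?_
    rw [h1]
    exact ha.trans hb.symm
  have hf : Function.Injective f :=
    M.edgePerm.injective.comp (M.vertexPerm.injective.comp M.vertexPerm.injective)
  have hg : Function.Injective g :=
    hf.comp M.vertexPerm.injective
  have h1 := Set.ncard_le_ncard hsub (Set.toFinite _)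
  rw [Set.ncard_union_eq hdisj, Set.ncard_image_of_injective _ hf,
    Set.ncard_image_of_injective _ hg] at h1
  rw [boundaryLength]
  omega

/-- By pigeonhole, a failure gives an outer vertex with three inward darts out of four, and these
are cyclically consecutive. -/
theorem ncard_inwardDarts_le (hM : M.IsPrime) (hmin : M.IsMinimal) (R : M.Region) :
    (inwardDarts R).ncard ≤ (M.boundaryVertices R)ᶜ.ncard * 2 := by
  classical
  have := Fintype.ofFinite M.Vertex
  by_contra! hlt
  rw [Set.ncard_eq_toFinset_card', Set.ncard_eq_toFinset_card'] at hlt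
  obtain ⟨w, -, hw⟩ := Finset.exists_lt_card_fiber_of_mul_lt_card_of_maps_to (f := M.origin)
    (fun d hd => by
      rw [Set.mem_toFinset] at hd ⊢
      exact hd.1) hlt
  set s := (inwardDarts R).toFinset.filter fun d => M.origin d = w with hs
  have hmem : ∀ d, d ∈ s ↔ d ∈ inwardDarts R ∧ M.origin d = w := by simp [hs]
  have hfalse : ∀ d, d ∈ s → M.vertexPerm d ∈ s → M.vertexPerm (M.vertexPerm d) ∈ s → False := by
    intro d h0 h1 h2
    rw [hmem] at h0 h1 h2
    exact not_three_consecutive hM hmin h0.1.1 h0.1.2 h1.1.2 h2.1.2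
  have ho : ∀ d, M.origin d = w → M.origin (M.vertexPerm d) = w :=
    fun d hd => (M.origin_vertexPerm d).trans hd
  have hex : ∃ m, M.origin m = w ∧ ∀ d, M.origin d = w → d ≠ m → d ∈ s := by
    obtain ⟨c, hc⟩ := M.origin_surjective w
    by_cases hall : ∀ d, M.origin d = w → d ∈ s
    · exact ⟨c, hc, fun d hd _ => hall d hd⟩
    push Not at hall
    obtain ⟨m, hm, hms⟩ := hall
    refine ⟨m, hm, fun d hd hdm => ?_⟩
    by_contra hds
    have h1 : insert d (insert m s) ⊆ Finset.univ.filter fun e => M.origin e = M.origin c := by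
      intro e he
      simp only [Finset.mem_insert, Finset.mem_filter, Finset.mem_univ, true_and] at he ⊢
      rcases he with rfl | rfl | he
      · exact hd.trans hc.symm
      · exact hm.trans hc.symm
      · exact ((hmem e).1 he).2.trans hc.symm
    have h2 := Finset.card_le_card h1
    rw [Finset.card_insert_of_notMem (by simp [hdm, hds]), Finset.card_insert_of_notMem hms] at h2
    have h3 := M.ncard_origin_eq c
    rw [Set.ncard_eq_toFinset_card', Set.toFinset_ofPred] at h3
    omega
  obtain ⟨m, hm, hms⟩ := hex
  obtain ⟨-, n1, n2⟩ := M.vertexPerm_four m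
  exact hfalse (M.vertexPerm m) (hms _ (ho _ hm) n1) (hms _ (ho _ (ho _ hm)) n2)
    (hms _ (ho _ (ho _ (ho _ hm))) (M.vertexPerm_three_ne m))

theorem regions_innerComplement_nonempty (hM : M.IsPrime) (hmin : M.IsMinimal) (R : M.Region) :
    (M.innerComplement R).regions.Nonempty := by
  by_contra hc
  have hR : ∀ F, ∃ d, M.region d = F ∧ M.origin d ∈ M.boundaryVertices R := by
    intro F
    by_contra! hF
    exact hc ⟨F, hF⟩
  have h1 := card_region_le hR
  have h2 := M.card_region_eq
  have h3 := two_mul_boundaryLength_le hM hmin R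
  have h4 := ncard_inwardDarts_le hM hmin R
  have h5 := Set.ncard_add_ncard_compl (M.boundaryVertices R)
  have h6 := hM.ncard_boundaryVertices R
  have h7 : 3 < Nat.card M.Vertex := hM.1
  omega

end DoodleDiagram

theorem theorem4p3 {D : Type*} [Fintype D] (M : DoodleDiagram D) (hmin : M.IsMinimal)
    (hprime : M.IsPrime) (R : M.Region) :
    Subsingleton (M.innerComplement R).H₁ ∧ (M.innerComplement R).regions.Nonempty :=
  ⟨M.subsingleton_H₁_innerComplement R,
    DoodleDiagram.regions_innerComplement_nonempty hprime hmin R⟩
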